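/- For $t>0$ and $x,y\in[0,1]$ let $$G_t(x,y)=2\sum_{n=1}^\infty \sin(n\pi x)\sin(n\pi y)\,e^{-n^2\pi^2t/2}$$ be the Dirichlet heat kernel on $[0,1]$, and write $\mathscr D(t)=(0,t]\times[0,1]$. For a space-time function $f$ let $$L_f(t,x)=\int_{\mathscr D(t)}G_{t-s}(x,y)f(s,y)\,ds\,dy ,\qquad \|f\|_{\mathscr C_1(\alpha,\beta)}=\sup_{(t,x)\in\mathscr D(1)}t^{\alpha}e^{-\beta t}|f(t,x)| ,$$ and for a random field $X=\{X(t,x)\}_{t>0,\,x\in[0,1]}$ and $k\ge1$ let $$\mathcal N_{k,\alpha,\beta,1}(X)=\sup_{(t,x)\in\mathscr D(1)}t^{\alpha}e^{-\beta t}\bigl(\mathbb E|X(t,x)|^k\bigr)^{1/k}.$$ **Proposition.** For all $\alpha\in(0,1)$ and $\bar\alpha>\alpha$ there is a number $c=c(\alpha,\bar\alpha)>0$, depending on nothing else, such that the following holds for every filtered probability space, all real numbers $\beta\ge e$ and $k\ge2$, and every predictable random field $X$ with $\mathcal N_{k,\alpha,\beta,1}(X)<\infty$. Almost surely, the integral defining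 $L_X(t,x)$ converges absolutely for every $(t,x)\in\mathscr D(1)$, the function $L_X$ is continuous on $\mathscr D(1)$, and $\|L_X\|_{\mathscr C_1(\bar\alpha,2\beta)}<\infty$; moreover $\|L_X\|_{\mathscr C_1(\bar\alpha,2\beta)}$ is a random variable (up to a null set), and for every $\delta\in(0,1)$, $$\mathbb E\Bigl(\|L_X\|_{\mathscr C_1(\bar\alpha,2\beta)}^k\Bigr)\le\left(\frac{c\,\mathcal N_{k,\alpha,\beta,1}(X)}{\beta^{(1-\delta)/2}}\right)^k .$$ -/

import Mathlib

open MeasureTheory Set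
open scoped ENNReal NNReal

noncomputable section

namespace HeatConv

/-- The Dirichlet heat kernel of `∂ₜ - ½ ∂ₓ²` on `[0, 1]`,
`G_t(x, y) = 2 ∑_{n ≥ 1} sin(nπx) sin(nπy) exp(-n²π²t/2)`.
The series converges absolutely for every `t > 0`; only such `t` matter below. -/
def heatKernel (t x y : ℝ) : ℝ :=
  2 * ∑' n : ℕ, Real.sin ((n + 1 : ℝ) * Real.pi * x) * Real.sin ((n + 1 : ℝ) * Real.pi * y) *
    Real.exp (-((n + 1 : ℝ) ^ 2 * Real.pi ^ 2 * t / 2))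

/-- The space-time strip `𝒟(T) = (0, T] × [0, 1]`. -/
def strip (T : ℝ) : Set (ℝ × ℝ) := Ioc 0 T ×ˢ Icc 0 1

/-- The integrand `(s, y) ↦ G_{t-s}(x, y) f(s, y)` of the convolution at `(t, x)`. -/
def convIntegrand (f : ℝ → ℝ → ℝ) (t x : ℝ) (p : ℝ × ℝ) : ℝ :=
  heatKernel (t - p.1) x p.2 * f p.1 p.2

/-- The Lebesgue convolution
`L_f(t, x) = ∫_{𝒟(t)} G_{t-s}(x, y) f(s, y) ds dy`. -/
def lebConv (f : ℝ → ℝ → ℝ) (t x : ℝ) : ℝ :=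
  ∫ p in strip t, convIntegrand f t x p

/-- The weighted sup-norm
`‖f‖_{C_T(α, β)} = sup_{(t, x) ∈ 𝒟(T)} t^α e^{-βt} |f(t, x)|`, with values in `[0, ∞]`. -/
def weightedSup (T α β : ℝ) (f : ℝ → ℝ → ℝ) : ℝ≥0∞ :=
  ⨆ p ∈ strip T, ENNReal.ofReal (p.1 ^ α * Real.exp (-β * p.1)) * ‖f p.1 p.2‖ₑ

/-- `f` belongs to `C_T(α, β)` up to time `T`: it is continuous on `𝒟(T)` and
its weighted sup-norm is finite. -/
def MemWeighted (T α β : ℝ) (f : ℝ → ℝ → ℝ) : Prop :=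
  ContinuousOn (fun p : ℝ × ℝ => f p.1 p.2) (strip T) ∧ weightedSup T α β f < ∞

/-- `𝒩_{k,α,β,T}(X) = sup_{(t, x) ∈ 𝒟(T)} t^α e^{-βt} ‖X(t, x)‖_k`, where `‖·‖_k` is the norm of
`L^k(Ω, P)`; with values in `[0, ∞]`. -/
def momentNorm {Ω : Type*} [MeasurableSpace Ω] (P : Measure Ω) (k α β T : ℝ)
    (X : ℝ → ℝ → Ω → ℝ) : ℝ≥0∞ :=
  ⨆ p ∈ strip T, ENNReal.ofReal (p.1 ^ α * Real.exp (-β * p.1)) *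
    eLpNorm (X p.1 p.2) (ENNReal.ofReal k) P

/-- The field `{X(t, x)}_{t > 0, x ∈ [0, 1]}` is predictable: the map `((t, ω), x) ↦ X(t, x)(ω)` is
measurable for the product of the predictable σ-algebra on `[0, ∞) × Ω` and the Borel σ-algebra
of `[0, 1]`. The field is indexed by `t > 0` only, so it is extended by `0` to `t = 0`. -/
def IsPredictableField {Ω : Type*} [mΩ : MeasurableSpace Ω] (ℱ : Filtration ℝ≥0 mΩ)
    (X : ℝ → ℝ → Ω → ℝ) : Prop :=
  Measurable[ℱ.predictable.prod (inferInstance : MeasurableSpace (Icc (0 : ℝ) 1))]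
    (fun q : (ℝ≥0 × Ω) × Icc (0 : ℝ) 1 => if q.1.1 = 0 then 0 else X q.1.1 q.2 q.1.2)

/-- The space `𝒫_{k,α,β}` of predictable fields `X` with `𝒩_{k,α,β,1}(X) < ∞`. -/
structure MemPredictable {Ω : Type*} [mΩ : MeasurableSpace Ω] (P : Measure Ω)
    (ℱ : Filtration ℝ≥0 mΩ) (k α β : ℝ) (X : ℝ → ℝ → Ω → ℝ) : Prop where
  predictable : IsPredictableField ℱ X
  momentNorm_lt_top : momentNorm P k α β 1 X < ∞

end HeatConv

end

/-!
Write `E(f) = ∫_{𝒟(1)} s^α exp (-3βs) |f(s, y)|² ds dy`. The argument is a pathwise Cauchy–Schwarz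
inequality with the weight `w(s) = s^{-α} exp (3βs)` on the kernel and `w⁻¹` on the field.

Pathwise, Parseval's identity for the sines gives `∫₀¹ G_t(x, y)² dy ≤ 2 t^{-1/2}`
(`lintegral_heatKernel_sq_le`), hence
`∫_{𝒟(t)} G_{t-s}(x, y)² w(s) ds dy ≤ C t^{1/2-α} exp (3βt)`, where `C` depends only on `α`.
Multiplied by the square of `t^αbar exp (-2βt)` the right side is at most
`C t^α exp (-βt) ≤ C β^{-α}`, and therefore `‖L_f‖² ≤ C β^{-α} E(f)` (`weightedSup_lebConv_le`).
When `E(f) < ∞`, the same inequality applied to the times `s ∈ [t - r, t)` shows that `L_f` is a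
locally uniform limit, as `r → 0`, of convolutions with the kernel cut off near its singularity.
These are continuous, and so is `L_f` (`continuousOn_lebConv`).

For a random field, `E(X) = ∫ |s^α exp (-βs) X|² dν` with the finite measure
`dν = s^{-α} exp (-βs) ds dy`, of mass at most `Γ(1-α) β^{-(1-α)}`. As `k / 2 ≥ 1`, Jensen's
inequality and Tonelli's theorem bound the moment of order `k / 2` of `E(X)` by
`𝒩^k ν(𝒟(1))^{k/2}` (`lintegral_energy_rpow_le`). The two powers of `β` multiply to `β⁻¹`. The square
root is `β^{-1/2}`, which is at most `β^{-(1-δ)/2}` for every `δ > 0`, with a constant free of `δ`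
and `k`. Measurability of the norm follows from continuity, since a countable dense set of points
computes the supremum.
-/

open MeasureTheory Set
open scoped ENNReal NNReal

noncomputable section

namespace HeatConv

/-! ### The Dirichlet heat kernel -/

/-- The partial sums telescope, since
`exp (-(n + 1)² u²) ≤ 1 / (1 + (n + 1)² u²) ≤ (2 / u) (1 / (1 + n u) - 1 / (1 + (n + 1) u))`. -/
lemma sum_range_exp_neg_sq_le {u : ℝ} (hu : 0 < u) (N : ℕ) :
    ∑ n ∈ Finset.range N, Real.exp (-(((n : ℝ) + 1) ^ 2 * u ^ 2)) ≤ 2 / u := by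
  have key : ∀ n : ℕ, Real.exp (-(((n : ℝ) + 1) ^ 2 * u ^ 2)) ≤
      2 / u * (1 / (1 + n * u)) - 2 / u * (1 / (1 + ((n + 1 : ℕ) : ℝ) * u)) := by
    intro n
    have hn : (0 : ℝ) ≤ n := Nat.cast_nonneg n
    have h1 : Real.exp (-(((n : ℝ) + 1) ^ 2 * u ^ 2)) ≤ 1 / (1 + ((n : ℝ) + 1) ^ 2 * u ^ 2) := by
      rw [Real.exp_neg, ← one_div]
      apply one_div_le_one_div_of_le (by positivity)
      linarith [Real.add_one_le_exp (((n : ℝ) + 1) ^ 2 * u ^ 2)]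
    refine h1.trans ?_
    have h2 : 2 / u * (1 / (1 + n * u)) - 2 / u * (1 / (1 + ((n + 1 : ℕ) : ℝ) * u)) =
        2 / ((1 + n * u) * (1 + (n + 1) * u)) := by
      push_cast
      field_simp
      ring
    rw [h2, div_le_div_iff₀ (by positivity) (by positivity)]
    have : 0 ≤ n * u := by positivity
    nlinarith [sq_nonneg ((n + 1) * u - 1)]
  calc _ ≤ ∑ n ∈ Finset.range N,
        (2 / u * (1 / (1 + n * u)) - 2 / u * (1 / (1 + ((n + 1 : ℕ) : ℝ) * u))) :=
        Finset.sum_le_sum fun n _ => key n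
    _ = 2 / u * (1 / (1 + (0 : ℕ) * u)) - 2 / u * (1 / (1 + N * u)) :=
        Finset.sum_range_sub' (fun n : ℕ => 2 / u * (1 / (1 + n * u))) N
    _ ≤ 2 / u := by
        have : 0 ≤ 2 / u * (1 / (1 + N * u)) := by positivity
        simp only [Nat.cast_zero, zero_mul, add_zero, div_one, mul_one]
        linarith

lemma summable_exp_neg_sq {u : ℝ} (hu : 0 < u) :
    Summable fun n : ℕ => Real.exp (-(((n : ℝ) + 1) ^ 2 * u ^ 2)) :=
  summable_of_sum_range_le (fun _ => (Real.exp_pos _).le) (sum_range_exp_neg_sq_le hu)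

lemma exp_heat_eq {t : ℝ} (ht : 0 < t) (n : ℕ) :
    Real.exp (-((n + 1 : ℝ) ^ 2 * Real.pi ^ 2 * t / 2)) =
      Real.exp (-(((n : ℝ) + 1) ^ 2 * (Real.pi * √(t / 2)) ^ 2)) := by
  rw [mul_pow, Real.sq_sqrt (by positivity)]
  ring_nf

lemma summable_exp_heat {t : ℝ} (ht : 0 < t) :
    Summable fun n : ℕ => Real.exp (-((n + 1 : ℝ) ^ 2 * Real.pi ^ 2 * t / 2)) := by
  simp_rw [exp_heat_eq ht]
  exact summable_exp_neg_sq (by positivity)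

lemma norm_heat_term_le (n : ℕ) (t x y : ℝ) :
    ‖Real.sin ((n + 1 : ℝ) * Real.pi * x) * Real.sin ((n + 1 : ℝ) * Real.pi * y) *
      Real.exp (-((n + 1 : ℝ) ^ 2 * Real.pi ^ 2 * t / 2))‖ ≤
      Real.exp (-((n + 1 : ℝ) ^ 2 * Real.pi ^ 2 * t / 2)) := by
  rw [norm_mul, norm_mul, Real.norm_eq_abs, Real.norm_eq_abs, Real.norm_eq_abs, Real.abs_exp]
  have h := mul_le_one₀ (Real.abs_sin_le_one ((n + 1 : ℝ) * Real.pi * x)) (abs_nonneg _)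
    (Real.abs_sin_le_one ((n + 1 : ℝ) * Real.pi * y))
  exact mul_le_of_le_one_left (Real.exp_pos _).le h

lemma exp_heat_anti {r t : ℝ} (h : r ≤ t) (n : ℕ) :
    Real.exp (-((n + 1 : ℝ) ^ 2 * Real.pi ^ 2 * t / 2)) ≤
      Real.exp (-((n + 1 : ℝ) ^ 2 * Real.pi ^ 2 * r / 2)) := by
  gcongr

/-- Away from `t = 0` the heat kernel is bounded. -/
lemma abs_heatKernel_le {r t : ℝ} (hr : 0 < r) (h : r ≤ t) (x y : ℝ) :
    |heatKernel t x y| ≤ 2 * ∑' n : ℕ, Real.exp (-((n + 1 : ℝ) ^ 2 * Real.pi ^ 2 * r / 2)) := by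
  rw [heatKernel, abs_mul, abs_two]
  gcongr
  exact tsum_of_norm_bounded (summable_exp_heat hr).hasSum
    fun n => (norm_heat_term_le n t x y).trans (exp_heat_anti h n)

lemma continuousOn_heatKernel :
    ContinuousOn (fun q : ℝ × ℝ × ℝ => heatKernel q.1 q.2.1 q.2.2) (Ioi 0 ×ˢ univ) := by
  have hloc : ∀ r : ℝ, 0 < r → ContinuousOn
      (fun q : ℝ × ℝ × ℝ => heatKernel q.1 q.2.1 q.2.2) (Ioi r ×ˢ univ) := by
    intro r hr
    unfold heatKernel
    refine continuousOn_const.mul (continuousOn_tsum (fun n => ?_) (summable_exp_heat hr) ?_)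
    · fun_prop
    · rintro n ⟨t, x, y⟩ ⟨ht, -⟩
      exact (norm_heat_term_le n t x y).trans (exp_heat_anti (le_of_lt ht) n)
  rintro ⟨t, x, y⟩ ⟨ht, -⟩
  have ht' : 0 < t := ht
  have hopen : IsOpen (Ioi (t / 2) ×ˢ (univ : Set (ℝ × ℝ))) := isOpen_Ioi.prod isOpen_univ
  have hmem : (t, x, y) ∈ Ioi (t / 2) ×ˢ (univ : Set (ℝ × ℝ)) :=
    ⟨half_lt_self ht', mem_univ _⟩
  exact ((hloc (t / 2) (half_pos ht')).continuousAt (hopen.mem_nhds hmem)).continuousWithinAt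

lemma integral_cos_int_mul_pi (j : ℤ) :
    ∫ y in (0 : ℝ)..1, Real.cos (j * Real.pi * y) = if j = 0 then 1 else 0 := by
  split_ifs with hj
  · simp [hj]
  · have hc : (j : ℝ) * Real.pi ≠ 0 := mul_ne_zero (Int.cast_ne_zero.2 hj) Real.pi_ne_zero
    simp [intervalIntegral.integral_comp_mul_left _ hc, Real.sin_int_mul_pi]

lemma integral_sin_mul_sin (n m : ℕ) :
    ∫ y in (0 : ℝ)..1, Real.sin ((n + 1 : ℝ) * Real.pi * y) * Real.sin ((m + 1 : ℝ) * Real.pi * y)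
      = if n = m then 1 / 2 else 0 := by
  have h : ∀ y : ℝ, Real.sin ((n + 1 : ℝ) * Real.pi * y) * Real.sin ((m + 1 : ℝ) * Real.pi * y) =
      1 / 2 * Real.cos (((n - m : ℤ) : ℝ) * Real.pi * y) -
        1 / 2 * Real.cos (((n + m + 2 : ℤ) : ℝ) * Real.pi * y) := by
    intro y
    have h1 : ((n - m : ℤ) : ℝ) * Real.pi * y =
        (n + 1 : ℝ) * Real.pi * y - (m + 1 : ℝ) * Real.pi * y := by push_cast; ring
    have h2 : ((n + m + 2 : ℤ) : ℝ) * Real.pi * y =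
        (n + 1 : ℝ) * Real.pi * y + (m + 1 : ℝ) * Real.pi * y := by push_cast; ring
    rw [h1, h2, Real.cos_sub, Real.cos_add]
    ring
  simp_rw [h]
  rw [intervalIntegral.integral_sub, intervalIntegral.integral_const_mul,
    intervalIntegral.integral_const_mul, integral_cos_int_mul_pi, integral_cos_int_mul_pi,
    if_neg (show ¬((n : ℤ) + m + 2 = 0) by omega)]
  · by_cases hnm : n = m
    · simp [hnm]
    · rw [if_neg (show ¬((n : ℤ) - m = 0) by omega), if_neg hnm]
      simp
  all_goals exact Continuous.intervalIntegrable (by fun_prop) _ _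

lemma integral_sine_sum_sq (a : ℕ → ℝ) (N : ℕ) :
    ∫ y in (0 : ℝ)..1, (∑ n ∈ Finset.range N, a n * Real.sin ((n + 1 : ℝ) * Real.pi * y)) ^ 2 =
      ∑ n ∈ Finset.range N, a n ^ 2 / 2 := by
  have h : ∀ y : ℝ, (∑ n ∈ Finset.range N, a n * Real.sin ((n + 1 : ℝ) * Real.pi * y)) ^ 2 =
      ∑ n ∈ Finset.range N, ∑ m ∈ Finset.range N, a n * a m *
        (Real.sin ((n + 1 : ℝ) * Real.pi * y) * Real.sin ((m + 1 : ℝ) * Real.pi * y)) := by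
    intro y
    rw [sq, Finset.sum_mul_sum]
    exact Finset.sum_congr rfl fun n _ => Finset.sum_congr rfl fun m _ => by ring
  simp_rw [h]
  rw [intervalIntegral.integral_finsetSum
    fun n _ => Continuous.intervalIntegrable (by fun_prop) _ _]
  refine Finset.sum_congr rfl fun n hn => ?_
  rw [intervalIntegral.integral_finsetSum
    fun n _ => Continuous.intervalIntegrable (by fun_prop) _ _]
  simp_rw [intervalIntegral.integral_const_mul, integral_sin_mul_sin]
  simp only [mul_ite, mul_zero, Finset.sum_ite_eq, hn, if_true]
  ring

/-- The energy bound `∫₀¹ G_t(x, y)² dy = 2 ∑ sin² (nπx) exp (-n²π²t) ≤ 2 t^{-1/2}`, by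
orthogonality of the sines. Fatou's lemma suffices to pass from partial sums to the series. -/
lemma lintegral_heatKernel_sq_le {t : ℝ} (ht : 0 < t) (x : ℝ) :
    ∫⁻ y in Icc (0 : ℝ) 1, ‖heatKernel t x y‖ₑ ^ 2 ≤
      ENNReal.ofReal (2 * t ^ (-(1 / 2) : ℝ)) := by
  set a : ℕ → ℝ := fun n => 2 * (Real.sin ((n + 1 : ℝ) * Real.pi * x) *
    Real.exp (-((n + 1 : ℝ) ^ 2 * Real.pi ^ 2 * t / 2))) with ha
  set S : ℕ → ℝ → ℝ := fun N y =>
    ∑ n ∈ Finset.range N, a n * Real.sin ((n + 1 : ℝ) * Real.pi * y) with hS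
  have hcont : ∀ N, Continuous (S N) := fun N => by simp only [hS]; fun_prop
  have hlim : ∀ y, Filter.Tendsto (fun N => S N y) Filter.atTop (nhds (heatKernel t x y)) := by
    intro y
    have hsum := ((Summable.of_norm_bounded (summable_exp_heat ht)
      fun n => norm_heat_term_le n t x y).hasSum.mul_left 2).tendsto_sum_nat
    refine hsum.congr fun N => Finset.sum_congr rfl fun n _ => ?_
    simp only [ha]
    ring
  have hbound : ∀ N, ∫⁻ y in Icc (0 : ℝ) 1, ‖S N y‖ₑ ^ 2 ≤
      ENNReal.ofReal (2 * t ^ (-(1 / 2) : ℝ)) := by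
    intro N
    have h1 : ∀ y, ‖S N y‖ₑ ^ 2 = ENNReal.ofReal (S N y ^ 2) := fun y => by
      rw [← ofReal_norm, ← ENNReal.ofReal_pow (norm_nonneg _), Real.norm_eq_abs, sq_abs]
    simp_rw [h1]
    rw [← ofReal_integral_eq_lintegral_ofReal (f := fun y => S N y ^ 2)
      ((show Continuous fun y => S N y ^ 2 from (hcont N).pow 2).integrableOn_Icc)
      (Filter.Eventually.of_forall fun y => sq_nonneg _), integral_Icc_eq_integral_Ioc,
      ← intervalIntegral.integral_of_le zero_le_one, integral_sine_sum_sq]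
    refine ENNReal.ofReal_le_ofReal ?_
    have h2 : ∀ n ∈ Finset.range N, a n ^ 2 / 2 ≤
        2 * Real.exp (-(((n : ℝ) + 1) ^ 2 * (Real.pi * √t) ^ 2)) := by
      intro n _
      have h3 : Real.exp (-(((n : ℝ) + 1) ^ 2 * (Real.pi * √t) ^ 2)) =
          Real.exp (-((n + 1 : ℝ) ^ 2 * Real.pi ^ 2 * t / 2)) ^ 2 := by
        rw [← Real.exp_nat_mul, mul_pow, Real.sq_sqrt ht.le]
        congr 1
        push_cast
        ring
      rw [h3]
      have h4 : a n ^ 2 / 2 = 2 * (Real.sin ((n + 1 : ℝ) * Real.pi * x) ^ 2 *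
          Real.exp (-((n + 1 : ℝ) ^ 2 * Real.pi ^ 2 * t / 2)) ^ 2) := by
        simp only [ha]
        ring
      rw [h4]
      gcongr
      exact mul_le_of_le_one_left (by positivity) (Real.sin_sq_le_one _)
    refine (Finset.sum_le_sum h2).trans ?_
    rw [← Finset.mul_sum, Real.rpow_neg ht.le, ← Real.sqrt_eq_rpow]
    gcongr
    refine (sum_range_exp_neg_sq_le (by positivity) N).trans ?_
    have hs : 0 < √t := Real.sqrt_pos.2 ht
    rw [← one_div, div_le_div_iff₀ (by positivity) hs]
    nlinarith [Real.pi_gt_three]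
  calc _ = ∫⁻ y in Icc (0 : ℝ) 1, Filter.liminf (fun N => ‖S N y‖ₑ ^ 2) Filter.atTop := by
        refine lintegral_congr fun y => ?_
        exact (((ENNReal.continuous_pow 2).comp continuous_enorm).tendsto _ |>.comp
          (hlim y)).liminf_eq.symm
    _ ≤ Filter.liminf (fun N => ∫⁻ y in Icc (0 : ℝ) 1, ‖S N y‖ₑ ^ 2) Filter.atTop :=
        lintegral_liminf_le fun N => (hcont N).measurable.enorm.pow_const 2
    _ ≤ _ := Filter.liminf_le_of_le (by isBoundedDefault) fun b hb => by
        obtain ⟨N, hN⟩ := hb.exists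
        exact hN.trans (hbound N)

/-! ### Singular integrals in time -/

lemma lintegral_rpow_neg {a r : ℝ} (ha : a < 1) (hr : 0 ≤ r) :
    ∫⁻ s in Ioc 0 r, ENNReal.ofReal (s ^ (-a)) = ENNReal.ofReal (r ^ (1 - a) / (1 - a)) := by
  have hint : IntegrableOn (fun s : ℝ => s ^ (-a)) (Ioc 0 r) :=
    (intervalIntegrable_iff_integrableOn_Ioc_of_le hr).1
      (intervalIntegral.intervalIntegrable_rpow' (by linarith))
  rw [← ofReal_integral_eq_lintegral_ofReal hint
    ((ae_restrict_mem measurableSet_Ioc).mono fun s hs => Real.rpow_nonneg hs.1.le _),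
    ← intervalIntegral.integral_of_le hr, integral_rpow (Or.inl (by linarith)),
    show -a + 1 = 1 - a by ring, Real.zero_rpow (by linarith), sub_zero]

lemma lintegral_sub_rpow_neg {a r : ℝ} (ha : a < 1) (hr : 0 ≤ r) (t : ℝ) :
    ∫⁻ s in (fun s => t - s) ⁻¹' Ioc 0 r, ENNReal.ofReal ((t - s) ^ (-a)) =
      ENNReal.ofReal (r ^ (1 - a) / (1 - a)) := by
  have hm : MeasurableSet ((fun s => t - s) ⁻¹' Ioc 0 r) :=
    (measurable_const.sub measurable_id) measurableSet_Ioc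
  rw [← lintegral_rpow_neg ha hr, ← lintegral_indicator hm,
    ← lintegral_indicator measurableSet_Ioc,
    ← lintegral_sub_left_eq_self (fun s => (Ioc 0 r).indicator
      (fun s => ENNReal.ofReal (s ^ (-a))) s) t]
  rfl

/-- The two singularities of `(t - s)^{-1/2} s^{-α}` are separated by the midpoint `t / 2`. -/
lemma sub_rpow_mul_rpow_le {α t s : ℝ} (hα : 0 ≤ α) (hs : s ∈ Ioo 0 t) :
    (t - s) ^ (-(1 / 2) : ℝ) * s ^ (-α) ≤
      (t / 2) ^ (-(1 / 2) : ℝ) * s ^ (-α) + (t / 2) ^ (-α) * (t - s) ^ (-(1 / 2) : ℝ) := by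
  have hs0 : 0 < s := hs.1
  have hts : 0 < t - s := sub_pos.2 hs.2
  have ht : 0 < t / 2 := by linarith
  have p1 := Real.rpow_nonneg hs0.le (-α)
  have p2 := Real.rpow_nonneg hts.le (-(1 / 2) : ℝ)
  have p3 := Real.rpow_nonneg ht.le (-α)
  have p4 := Real.rpow_nonneg ht.le (-(1 / 2) : ℝ)
  rcases le_total s (t / 2) with h | h
  · have : (t - s) ^ (-(1 / 2) : ℝ) ≤ (t / 2) ^ (-(1 / 2) : ℝ) :=
      Real.rpow_le_rpow_of_nonpos ht (by linarith) (by norm_num)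
    nlinarith
  · have : s ^ (-α) ≤ (t / 2) ^ (-α) := Real.rpow_le_rpow_of_nonpos ht h (by linarith)
    nlinarith

/-- The weight `s^{-α} exp (3βs)` put on the heat kernel in the Cauchy–Schwarz inequality. -/
def weight (α β s : ℝ) : ℝ := s ^ (-α) * Real.exp (3 * β * s)

lemma measurable_weight (α β : ℝ) : Measurable (weight α β) := by
  unfold weight; fun_prop

lemma weight_pos {α β s : ℝ} (hs : 0 < s) : 0 < weight α β s := by
  unfold weight; positivity

/-- The constant in the bound of the time integral of the weighted kernel energy. -/
def energyConst (α : ℝ) : ℝ := 4 / (1 - α) + 8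

lemma energyConst_pos {α : ℝ} (hα : α < 1) : 0 < energyConst α := by
  have : 0 < 1 - α := sub_pos.2 hα
  unfold energyConst; positivity

lemma lintegral_weight_le {α β t : ℝ} (hα : α ∈ Ioo (0 : ℝ) 1) (hβ : 0 ≤ β) (ht : 0 < t) :
    ∫⁻ s in Ioo 0 t, ENNReal.ofReal (2 * (t - s) ^ (-(1 / 2) : ℝ)) *
      ENNReal.ofReal (weight α β s) ≤
      ENNReal.ofReal (energyConst α * t ^ (1 / 2 - α) * Real.exp (3 * β * t)) := by
  have hα1 : 0 < 1 - α := sub_pos.2 hα.2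
  have hh : 0 < t / 2 := half_pos ht
  set c1 : ℝ := 2 * Real.exp (3 * β * t) * (t / 2) ^ (-(1 / 2) : ℝ) with hc1
  set c2 : ℝ := 2 * Real.exp (3 * β * t) * (t / 2) ^ (-α) with hc2
  have hc1' : 0 ≤ c1 := by positivity
  have hc2' : 0 ≤ c2 := by positivity
  have hpt : ∀ s ∈ Ioo 0 t, ENNReal.ofReal (2 * (t - s) ^ (-(1 / 2) : ℝ)) *
      ENNReal.ofReal (weight α β s) ≤ ENNReal.ofReal c1 * ENNReal.ofReal (s ^ (-α)) +
        ENNReal.ofReal c2 * ENNReal.ofReal ((t - s) ^ (-(1 / 2) : ℝ)) := by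
    intro s hs
    have hs0 : 0 < s := hs.1
    have hts : 0 < t - s := sub_pos.2 hs.2
    rw [← ENNReal.ofReal_mul (by positivity), ← ENNReal.ofReal_mul hc1',
      ← ENNReal.ofReal_mul hc2', ← ENNReal.ofReal_add (by positivity) (by positivity)]
    apply ENNReal.ofReal_le_ofReal
    have he : Real.exp (3 * β * s) ≤ Real.exp (3 * β * t) := by
      have := hs.2.le
      gcongr
    calc 2 * (t - s) ^ (-(1 / 2) : ℝ) * weight α β s
        = 2 * Real.exp (3 * β * s) * ((t - s) ^ (-(1 / 2) : ℝ) * s ^ (-α)) := by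
          unfold weight; ring
      _ ≤ 2 * Real.exp (3 * β * t) * ((t / 2) ^ (-(1 / 2) : ℝ) * s ^ (-α) +
          (t / 2) ^ (-α) * (t - s) ^ (-(1 / 2) : ℝ)) := by
          gcongr
          exact sub_rpow_mul_rpow_le hα.1.le hs
      _ = _ := by rw [hc1, hc2]; ring
  have hsub : Ioo 0 t ⊆ (fun s => t - s) ⁻¹' Ioc 0 t := fun s hs =>
    ⟨sub_pos.2 hs.2, by linarith [hs.1]⟩
  calc _ ≤ ∫⁻ s in Ioo 0 t, (ENNReal.ofReal c1 * ENNReal.ofReal (s ^ (-α)) +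
        ENNReal.ofReal c2 * ENNReal.ofReal ((t - s) ^ (-(1 / 2) : ℝ))) :=
        setLIntegral_mono' measurableSet_Ioo hpt
    _ = ENNReal.ofReal c1 * (∫⁻ s in Ioo 0 t, ENNReal.ofReal (s ^ (-α))) +
        ENNReal.ofReal c2 * ∫⁻ s in Ioo 0 t, ENNReal.ofReal ((t - s) ^ (-(1 / 2) : ℝ)) := by
        rw [lintegral_add_left (by fun_prop), lintegral_const_mul _ (by fun_prop),
          lintegral_const_mul _ (by fun_prop)]
    _ ≤ ENNReal.ofReal c1 * ENNReal.ofReal (t ^ (1 - α) / (1 - α)) +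
        ENNReal.ofReal c2 * ENNReal.ofReal (t ^ (1 - 1 / 2 : ℝ) / (1 - 1 / 2)) := by
        rw [← lintegral_rpow_neg hα.2 ht.le,
          ← lintegral_sub_rpow_neg (by norm_num : (1 / 2 : ℝ) < 1) ht.le t]
        gcongr
        exact Ioo_subset_Ioc_self
    _ ≤ _ := by
        rw [← ENNReal.ofReal_mul hc1', ← ENNReal.ofReal_mul hc2',
          ← ENNReal.ofReal_add (by positivity) (by norm_num; positivity)]
        apply ENNReal.ofReal_le_ofReal
        have h2 : ∀ b : ℝ, 0 ≤ b → b ≤ 1 → (t / 2) ^ (-b) ≤ 2 * t ^ (-b) := by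
          intro b hb0 hb
          rw [Real.div_rpow ht.le (by norm_num), Real.rpow_neg (by norm_num : (0 : ℝ) ≤ 2) b,
            div_inv_eq_mul, mul_comm]
          gcongr
          simpa using Real.rpow_le_rpow_of_exponent_le (by norm_num : (1 : ℝ) ≤ 2) hb
        have e1 : t ^ (-(1 / 2) : ℝ) * t ^ (1 - α) = t ^ (1 / 2 - α) := by
          rw [← Real.rpow_add ht]; ring_nf
        have e2 : t ^ (-α) * t ^ (1 - 1 / 2 : ℝ) = t ^ (1 / 2 - α) := by
          rw [← Real.rpow_add ht]; ring_nf
        have b1 := h2 (1 / 2) (by norm_num) (by norm_num)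
        have b2 := h2 α hα.1.le hα.2.le
        calc c1 * (t ^ (1 - α) / (1 - α)) + c2 * (t ^ (1 - 1 / 2 : ℝ) / (1 - 1 / 2))
            ≤ 2 * Real.exp (3 * β * t) * (2 * t ^ (-(1 / 2) : ℝ)) * (t ^ (1 - α) / (1 - α)) +
              2 * Real.exp (3 * β * t) * (2 * t ^ (-α)) *
                (t ^ (1 - 1 / 2 : ℝ) / (1 - 1 / 2)) := by
              rw [hc1, hc2]
              have : (0 : ℝ) ≤ t ^ (1 - 1 / 2 : ℝ) / (1 - 1 / 2) := by norm_num; positivity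
              gcongr
          _ = 4 * Real.exp (3 * β * t) / (1 - α) * (t ^ (-(1 / 2) : ℝ) * t ^ (1 - α)) +
              8 * Real.exp (3 * β * t) * (t ^ (-α) * t ^ (1 - 1 / 2 : ℝ)) := by ring
          _ = _ := by rw [e1, e2, energyConst]; ring

lemma lintegral_weight_near_le {α β t r τ : ℝ} (hα : 0 ≤ α) (hβ : 0 ≤ β) (hτ : 0 < τ)
    (ht : t ≤ 1) (hr : 0 ≤ r) (hτt : τ ≤ t - r) :
    ∫⁻ s in (fun s => t - s) ⁻¹' Ioc 0 r, ENNReal.ofReal (2 * (t - s) ^ (-(1 / 2) : ℝ)) *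
      ENNReal.ofReal (weight α β s) ≤
      ENNReal.ofReal (4 * τ ^ (-α) * Real.exp (3 * β) * r ^ (1 / 2 : ℝ)) := by
  have hm : MeasurableSet ((fun s => t - s) ⁻¹' Ioc 0 r) :=
    (measurable_const.sub measurable_id) measurableSet_Ioc
  set c : ℝ := 2 * τ ^ (-α) * Real.exp (3 * β) with hc
  have hc' : 0 ≤ c := by positivity
  calc _ ≤ ∫⁻ s in (fun s => t - s) ⁻¹' Ioc 0 r,
        ENNReal.ofReal c * ENNReal.ofReal ((t - s) ^ (-(1 / 2) : ℝ)) := by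
        refine setLIntegral_mono' hm fun s hs => ?_
        have hts : 0 < t - s := hs.1
        have hsτ : τ ≤ s := by linarith [hs.2]
        have hs0 : 0 < s := hτ.trans_le hsτ
        rw [← ENNReal.ofReal_mul (by positivity), ← ENNReal.ofReal_mul hc']
        apply ENNReal.ofReal_le_ofReal
        have h1 : s ^ (-α) ≤ τ ^ (-α) := Real.rpow_le_rpow_of_nonpos hτ hsτ (by linarith)
        have h2 : Real.exp (3 * β * s) ≤ Real.exp (3 * β) := by
          apply Real.exp_le_exp.2
          nlinarith
        calc 2 * (t - s) ^ (-(1 / 2) : ℝ) * weight α β s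
            ≤ 2 * (t - s) ^ (-(1 / 2) : ℝ) * (τ ^ (-α) * Real.exp (3 * β)) := by
              unfold weight; gcongr
          _ = _ := by rw [hc]; ring
    _ = ENNReal.ofReal c * ENNReal.ofReal (r ^ (1 - 1 / 2 : ℝ) / (1 - 1 / 2)) := by
        rw [lintegral_const_mul _ (by fun_prop), lintegral_sub_rpow_neg (by norm_num) hr]
    _ = _ := by
        rw [← ENNReal.ofReal_mul hc', hc]
        congr 1
        norm_num
        ring

/-- The weight of the sup-norm balances the kernel energy. The surplus exponent
`2 αbar - 2 α + 1 / 2` of `t` is dropped, and `t^α exp (-βt) ≤ β^{-α}` does the rest. -/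
lemma sup_weight_mul_energy_le {α αbar β t : ℝ} (hα : α ∈ Ioo (0 : ℝ) 1) (hαbar : α < αbar)
    (hβ : 0 < β) (ht : t ∈ Ioc (0 : ℝ) 1) :
    (t ^ αbar * Real.exp (-(2 * β) * t)) ^ 2 *
      (energyConst α * t ^ (1 / 2 - α) * Real.exp (3 * β * t)) ≤ energyConst α * β ^ (-α) := by
  have ht0 := ht.1
  have hC := energyConst_pos hα.2
  have e1 : (t ^ αbar) ^ 2 * t ^ (1 / 2 - α) = t ^ (2 * αbar + (1 / 2 - α)) := by
    rw [← Real.rpow_natCast, ← Real.rpow_mul ht0.le, ← Real.rpow_add ht0]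
    congr 1; push_cast; ring
  have e2 : Real.exp (-(2 * β) * t) ^ 2 * Real.exp (3 * β * t) = Real.exp (-(β * t)) := by
    rw [← Real.exp_nat_mul, ← Real.exp_add]; congr 1; push_cast; ring
  have h1 : t ^ (2 * αbar + (1 / 2 - α)) ≤ t ^ α :=
    Real.rpow_le_rpow_of_exponent_ge ht0 ht.2 (by linarith)
  have h2 : (β * t) ^ α * Real.exp (-(β * t)) ≤ 1 := by
    have hu : 0 ≤ β * t := by positivity
    rw [Real.exp_neg, ← div_eq_mul_inv, div_le_one (Real.exp_pos _)]
    calc (β * t) ^ α ≤ (1 + β * t) ^ α :=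
          Real.rpow_le_rpow hu (by linarith) hα.1.le
      _ ≤ (1 + β * t) ^ (1 : ℝ) :=
          Real.rpow_le_rpow_of_exponent_le (by linarith) hα.2.le
      _ ≤ _ := by rw [Real.rpow_one]; linarith [Real.add_one_le_exp (β * t)]
  have h3 : t ^ α * Real.exp (-(β * t)) ≤ β ^ (-α) := by
    rw [Real.mul_rpow hβ.le ht0.le] at h2
    rw [Real.rpow_neg hβ.le, ← one_div, le_div_iff₀ (by positivity)]
    linarith
  calc _ = energyConst α * (((t ^ αbar) ^ 2 * t ^ (1 / 2 - α)) *
        (Real.exp (-(2 * β) * t) ^ 2 * Real.exp (3 * β * t))) := by ring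
    _ ≤ energyConst α * (t ^ α * Real.exp (-(β * t))) := by
        rw [e1, e2]; gcongr
    _ ≤ _ := by gcongr

lemma lintegral_rpow_neg_mul_exp_le {α β : ℝ} (hα : α < 1) (hβ : 0 < β) :
    ∫⁻ s in Ioc (0 : ℝ) 1, ENNReal.ofReal (s ^ (-α) * Real.exp (-(β * s))) ≤
      ENNReal.ofReal (Real.Gamma (1 - α) * β ^ (-(1 - α))) := by
  have hα1 : 0 < 1 - α := sub_pos.2 hα
  have hval := Real.integral_rpow_mul_exp_neg_mul_Ioi hα1 hβ
  have hpos : 0 < (1 / β) ^ (1 - α) * Real.Gamma (1 - α) :=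
    mul_pos (by positivity) (Real.Gamma_pos_of_pos hα1)
  have hint : IntegrableOn (fun s : ℝ => s ^ (1 - α - 1) * Real.exp (-(β * s))) (Ioi 0) := by
    by_contra h
    exact hpos.ne' (hval.symm.trans (integral_undef h))
  calc _ ≤ ∫⁻ s in Ioi (0 : ℝ), ENNReal.ofReal (s ^ (-α) * Real.exp (-(β * s))) :=
        lintegral_mono_set Ioc_subset_Ioi_self
    _ = ∫⁻ s in Ioi (0 : ℝ), ENNReal.ofReal (s ^ (1 - α - 1) * Real.exp (-(β * s))) := by
        rw [show 1 - α - 1 = -α by ring]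
    _ = ENNReal.ofReal ((1 / β) ^ (1 - α) * Real.Gamma (1 - α)) := by
        rw [← ofReal_integral_eq_lintegral_ofReal hint
          ((ae_restrict_mem measurableSet_Ioi).mono fun s hs =>
            mul_nonneg (Real.rpow_nonneg (le_of_lt hs) _) (Real.exp_pos _).le), hval]
    _ ≤ _ := by
        rw [one_div, Real.inv_rpow hβ.le, Real.rpow_neg hβ.le, mul_comm]

/-! ### The convolution of a single function -/

/-- The kernel `(s, y) ↦ G_{t-s}(x, y)` cut down to the times `s` with `t - s ∈ A`. -/
def cutKernel (A : Set ℝ) (t x : ℝ) (p : ℝ × ℝ) : ℝ :=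
  ((fun p : ℝ × ℝ => t - p.1) ⁻¹' A).indicator (fun p => heatKernel (t - p.1) x p.2) p

lemma cutKernel_of_mem {A : Set ℝ} {t x : ℝ} {p : ℝ × ℝ} (h : t - p.1 ∈ A) :
    cutKernel A t x p = heatKernel (t - p.1) x p.2 :=
  indicator_of_mem (s := (fun p : ℝ × ℝ => t - p.1) ⁻¹' A) h _

lemma cutKernel_of_notMem {A : Set ℝ} {t x : ℝ} {p : ℝ × ℝ} (h : t - p.1 ∉ A) :
    cutKernel A t x p = 0 :=
  indicator_of_notMem (s := (fun p : ℝ × ℝ => t - p.1) ⁻¹' A) h _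

lemma measurable_sub_fst (t : ℝ) : Measurable fun p : ℝ × ℝ => t - p.1 :=
  measurable_const.sub measurable_fst

lemma measurable_cutKernel {A : Set ℝ} (hA : MeasurableSet A) (hA0 : A ⊆ Ioi 0) (t x : ℝ) :
    Measurable (cutKernel A t x) := by
  have hcont : ContinuousOn (fun p : ℝ × ℝ => heatKernel (t - p.1) x p.2)
      ((fun p : ℝ × ℝ => t - p.1) ⁻¹' Ioi 0) :=
    continuousOn_heatKernel.comp
      (f := fun p : ℝ × ℝ => (t - p.1, x, p.2)) (by fun_prop) fun p hp => ⟨hp, mem_univ _⟩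
  have hm : MeasurableSet ((fun p : ℝ × ℝ => t - p.1) ⁻¹' Ioi 0) :=
    measurable_sub_fst t measurableSet_Ioi
  have h0 : Measurable (cutKernel (Ioi 0) t x) := by
    classical
    have h := hcont.measurable_piecewise (continuousOn_const (c := (0 : ℝ))) hm
    convert h using 1
    ext p
    simp [cutKernel, piecewise, indicator]
  have : cutKernel A t x =
      ((fun p : ℝ × ℝ => t - p.1) ⁻¹' A).indicator (cutKernel (Ioi 0) t x) := by
    unfold cutKernel
    ext p
    rw [indicator_indicator, inter_eq_left.2 (preimage_mono hA0)]
  rw [this]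
  exact h0.indicator (measurable_sub_fst t hA)

lemma measurableSet_strip (T : ℝ) : MeasurableSet (strip T) :=
  measurableSet_Ioc.prod measurableSet_Icc

lemma restrict_strip (T : ℝ) : (volume : Measure (ℝ × ℝ)).restrict (strip T) =
    ((volume : Measure ℝ).restrict (Ioc 0 T)).prod ((volume : Measure ℝ).restrict (Icc 0 1)) := by
  rw [strip, Measure.volume_eq_prod, Measure.prod_restrict]

lemma lintegral_strip_fst {g : ℝ → ℝ≥0∞} (hg : Measurable g) (T : ℝ) :
    ∫⁻ p in strip T, g p.1 = ∫⁻ s in Ioc 0 T, g s := by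
  rw [restrict_strip, lintegral_prod _ (by fun_prop)]
  simp

lemma lintegral_cutKernel_sq_le {A : Set ℝ} (hA : MeasurableSet A) (hA0 : A ⊆ Ioi 0)
    (α β t x : ℝ) :
    ∫⁻ p in strip 1, ‖cutKernel A t x p‖ₑ ^ 2 * ENNReal.ofReal (weight α β p.1) ≤
      ∫⁻ s in Ioc 0 1 ∩ (fun s => t - s) ⁻¹' A,
        ENNReal.ofReal (2 * (t - s) ^ (-(1 / 2) : ℝ)) * ENNReal.ofReal (weight α β s) := by
  have hK := measurable_cutKernel hA hA0 t x
  have hw := measurable_weight α β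
  have hmA : MeasurableSet ((fun s => t - s) ⁻¹' A) := (measurable_const.sub measurable_id) hA
  rw [restrict_strip, lintegral_prod _ (by fun_prop), inter_comm, ← setLIntegral_indicator hmA]
  refine lintegral_mono fun s => ?_
  by_cases hs : t - s ∈ A
  · rw [indicator_of_mem (show s ∈ (fun s => t - s) ⁻¹' A from hs)]
    simp only [cutKernel_of_mem (p := (s, _)) hs]
    rw [lintegral_mul_const' _ _ ENNReal.ofReal_ne_top]
    gcongr
    exact lintegral_heatKernel_sq_le (hA0 hs) x
  · simp [cutKernel_of_notMem (p := (s, _)) hs]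

/-- The quantity `∫_{𝒟(1)} s^α exp (-3βs) |f(s, y)|² ds dy`. -/
def energy (α β : ℝ) (f : ℝ → ℝ → ℝ) : ℝ≥0∞ :=
  ∫⁻ p in strip 1, ‖f p.1 p.2‖ₑ ^ 2 * ENNReal.ofReal (weight α β p.1)⁻¹

/-- Cauchy–Schwarz against the weight. -/
lemma lintegral_mul_le_energy {α β : ℝ} {K : ℝ × ℝ → ℝ} {f : ℝ → ℝ → ℝ} (hK : Measurable K)
    (hf : AEStronglyMeasurable (fun p : ℝ × ℝ => f p.1 p.2) (volume.restrict (strip 1))) :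
    ∫⁻ p in strip 1, ‖K p * f p.1 p.2‖ₑ ≤
      (∫⁻ p in strip 1, ‖K p‖ₑ ^ 2 * ENNReal.ofReal (weight α β p.1)) ^ (1 / 2 : ℝ) *
        energy α β f ^ (1 / 2 : ℝ) := by
  have hw := measurable_weight α β
  have hfe := hf.enorm
  have h := ENNReal.lintegral_mul_le_Lp_mul_Lq (volume.restrict (strip 1))
    (Real.HolderConjugate.two_two)
    (f := fun p => ‖K p‖ₑ * ENNReal.ofReal (weight α β p.1) ^ (1 / 2 : ℝ))
    (g := fun p => ‖f p.1 p.2‖ₑ * ENNReal.ofReal (weight α β p.1)⁻¹ ^ (1 / 2 : ℝ))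
    (by fun_prop) (by fun_prop)
  have hsq : ∀ a b : ℝ≥0∞, (a * b ^ (1 / 2 : ℝ)) ^ (2 : ℝ) = a ^ 2 * b := fun a b => by
    rw [ENNReal.mul_rpow_of_nonneg _ _ (by norm_num), ← ENNReal.rpow_mul, ENNReal.rpow_two]
    norm_num
  simp only [hsq] at h
  refine le_trans (le_of_eq ?_) h
  refine setLIntegral_congr_fun (measurableSet_strip 1) fun p hp => ?_
  have hpos : 0 < weight α β p.1 := weight_pos hp.1.1
  have hone : ENNReal.ofReal (weight α β p.1) ^ (1 / 2 : ℝ) *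
      ENNReal.ofReal (weight α β p.1)⁻¹ ^ (1 / 2 : ℝ) = 1 := by
    rw [← ENNReal.mul_rpow_of_nonneg _ _ (by norm_num), ← ENNReal.ofReal_mul hpos.le,
      mul_inv_cancel₀ hpos.ne', ENNReal.ofReal_one, ENNReal.one_rpow]
  simp only [Pi.mul_apply]
  rw [enorm_mul, mul_mul_mul_comm, hone, mul_one]

lemma Ioo_prod_Icc_ae_eq_strip (t : ℝ) :
    (Ioo 0 t ×ˢ Icc 0 1 : Set (ℝ × ℝ)) =ᵐ[volume] strip t := by
  rw [Measure.volume_eq_prod]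
  exact Measure.set_prod_ae_eq Ioo_ae_eq_Ioc (Filter.EventuallyEq.refl _ _)

lemma strip_inter_preimage {t : ℝ} (ht : t ≤ 1) :
    strip 1 ∩ (fun p : ℝ × ℝ => t - p.1) ⁻¹' Ioi 0 = Ioo 0 t ×ˢ Icc 0 1 := by
  ext p
  simp only [strip, mem_inter_iff, mem_prod, mem_Ioc, mem_preimage, mem_Ioi, mem_Ioo, sub_pos]
  constructor
  · rintro ⟨⟨⟨h1, -⟩, h2⟩, h3⟩
    exact ⟨⟨h1, h3⟩, h2⟩
  · rintro ⟨⟨h1, h3⟩, h2⟩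
    exact ⟨⟨⟨h1, h3.le.trans ht⟩, h2⟩, h3⟩

lemma cutKernel_mul_eq_indicator (f : ℝ → ℝ → ℝ) (A : Set ℝ) (t x : ℝ) :
    (fun p : ℝ × ℝ => cutKernel A t x p * f p.1 p.2) =
      ((fun p : ℝ × ℝ => t - p.1) ⁻¹' A).indicator (convIntegrand f t x) := by
  ext p
  simp only [cutKernel, indicator, convIntegrand]
  split_ifs <;> simp

lemma integrableOn_convIntegrand_iff (f : ℝ → ℝ → ℝ) {t : ℝ} (ht : t ≤ 1) (x : ℝ) :
    IntegrableOn (convIntegrand f t x) (strip t) ↔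
      IntegrableOn (fun p => cutKernel (Ioi 0) t x p * f p.1 p.2) (strip 1) := by
  rw [cutKernel_mul_eq_indicator, IntegrableOn, IntegrableOn,
    integrable_indicator_iff (measurable_sub_fst t measurableSet_Ioi), IntegrableOn,
    Measure.restrict_restrict (measurable_sub_fst t measurableSet_Ioi), inter_comm,
    strip_inter_preimage ht, Measure.restrict_congr_set (Ioo_prod_Icc_ae_eq_strip t)]

lemma lebConv_eq_integral_cutKernel (f : ℝ → ℝ → ℝ) {t : ℝ} (ht : t ≤ 1) (x : ℝ) :
    lebConv f t x = ∫ p in strip 1, cutKernel (Ioi 0) t x p * f p.1 p.2 := by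
  rw [cutKernel_mul_eq_indicator, lebConv,
    setIntegral_indicator (measurable_sub_fst t measurableSet_Ioi), strip_inter_preimage ht,
    setIntegral_congr_set (Ioo_prod_Icc_ae_eq_strip t)]

section
variable {α αbar β : ℝ} {f : ℝ → ℝ → ℝ}

lemma lintegral_cutKernel_mul_le (hα : α ∈ Ioo (0 : ℝ) 1) (hβ : 0 ≤ β)
    (hf : AEStronglyMeasurable (fun p : ℝ × ℝ => f p.1 p.2) (volume.restrict (strip 1)))
    {t : ℝ} (ht : 0 < t) (x : ℝ) :
    ∫⁻ p in strip 1, ‖cutKernel (Ioi 0) t x p * f p.1 p.2‖ₑ ≤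
      (ENNReal.ofReal (energyConst α * t ^ (1 / 2 - α) * Real.exp (3 * β * t))) ^ (1 / 2 : ℝ) *
        energy α β f ^ (1 / 2 : ℝ) := by
  refine (lintegral_mul_le_energy (α := α) (β := β)
    (measurable_cutKernel measurableSet_Ioi subset_rfl t x) hf).trans ?_
  gcongr
  refine (lintegral_cutKernel_sq_le measurableSet_Ioi subset_rfl α β t x).trans
    (le_trans (lintegral_mono_set ?_) (lintegral_weight_le hα hβ ht))
  rintro s ⟨hs, hs'⟩
  exact ⟨hs.1, sub_pos.1 hs'⟩

lemma integrable_cutKernel_mul (hα : α ∈ Ioo (0 : ℝ) 1) (hβ : 0 ≤ β)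
    (hf : AEStronglyMeasurable (fun p : ℝ × ℝ => f p.1 p.2) (volume.restrict (strip 1)))
    (hfin : energy α β f ≠ ∞) {t : ℝ} (ht : 0 < t) (x : ℝ) :
    IntegrableOn (fun p => cutKernel (Ioi 0) t x p * f p.1 p.2) (strip 1) := by
  refine ⟨(measurable_cutKernel measurableSet_Ioi subset_rfl t x).aestronglyMeasurable.mul hf, ?_⟩
  refine (lintegral_cutKernel_mul_le hα hβ hf ht x).trans_lt ?_
  exact ENNReal.mul_lt_top (ENNReal.rpow_lt_top_of_nonneg (by norm_num) ENNReal.ofReal_ne_top)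
    (ENNReal.rpow_lt_top_of_nonneg (by norm_num) hfin)

lemma integrableOn_convIntegrand (hα : α ∈ Ioo (0 : ℝ) 1) (hβ : 0 ≤ β)
    (hf : AEStronglyMeasurable (fun p : ℝ × ℝ => f p.1 p.2) (volume.restrict (strip 1)))
    (hfin : energy α β f ≠ ∞) {t : ℝ} (ht : t ∈ Ioc (0 : ℝ) 1) (x : ℝ) :
    IntegrableOn (convIntegrand f t x) (strip t) :=
  (integrableOn_convIntegrand_iff f ht.2 x).2 (integrable_cutKernel_mul hα hβ hf hfin ht.1 x)

/-- The pathwise bound. It holds for every measurable `f`, whether or not the right side is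
finite. -/
lemma weightedSup_lebConv_le (hα : α ∈ Ioo (0 : ℝ) 1) (hαbar : α < αbar) (hβ : 0 < β)
    (hf : AEStronglyMeasurable (fun p : ℝ × ℝ => f p.1 p.2) (volume.restrict (strip 1))) :
    weightedSup 1 αbar (2 * β) (lebConv f) ≤
      (ENNReal.ofReal (energyConst α * β ^ (-α)) * energy α β f) ^ (1 / 2 : ℝ) := by
  refine iSup₂_le fun p hp => ?_
  have ht : p.1 ∈ Ioc (0 : ℝ) 1 := hp.1
  have ht0 := ht.1
  have hC := energyConst_pos hα.2
  have h1 := (enorm_integral_le_lintegral_enorm _).trans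
    (lintegral_cutKernel_mul_le hα hβ.le hf ht0 p.2)
  rw [← lebConv_eq_integral_cutKernel f ht.2] at h1
  set c : ℝ := p.1 ^ αbar * Real.exp (-(2 * β) * p.1) with hc
  have hc0 : 0 ≤ c := by positivity
  have hcr : ENNReal.ofReal c = ENNReal.ofReal (c ^ 2) ^ (1 / 2 : ℝ) := by
    rw [ENNReal.ofReal_rpow_of_nonneg (by positivity) (by norm_num), ← Real.sqrt_eq_rpow,
      Real.sqrt_sq hc0]
  calc _ ≤ ENNReal.ofReal c * _ := mul_le_mul_right h1 _
    _ = (ENNReal.ofReal (c ^ 2 * (energyConst α * p.1 ^ (1 / 2 - α) * Real.exp (3 * β * p.1))) *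
          energy α β f) ^ (1 / 2 : ℝ) := by
        rw [hcr, ENNReal.ofReal_mul (by positivity : 0 ≤ c ^ 2),
          ENNReal.mul_rpow_of_nonneg _ _ (by norm_num),
          ENNReal.mul_rpow_of_nonneg _ _ (by norm_num), mul_assoc (ENNReal.ofReal _ ^ _)]
    _ ≤ _ := by
        refine ENNReal.rpow_le_rpow (mul_le_mul_left ?_ _) (by norm_num)
        exact ENNReal.ofReal_le_ofReal (sup_weight_mul_energy_le hα hαbar hβ ht)

lemma integrableOn_of_energy_ne_top (hα : α < 1) (hβ : 0 ≤ β)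
    (hf : AEStronglyMeasurable (fun p : ℝ × ℝ => f p.1 p.2) (volume.restrict (strip 1)))
    (hfin : energy α β f ≠ ∞) : IntegrableOn (fun p => f p.1 p.2) (strip 1) := by
  refine ⟨hf, ?_⟩
  have h := lintegral_mul_le_energy (α := α) (β := β) (K := fun _ => 1) measurable_const hf
  simp only [one_mul, enorm_one, one_pow] at h
  refine h.trans_lt (ENNReal.mul_lt_top (ENNReal.rpow_lt_top_of_nonneg (by norm_num) ?_)
    (ENNReal.rpow_lt_top_of_nonneg (by norm_num) hfin))
  have hw := measurable_weight α β
  rw [lintegral_strip_fst (g := fun s => ENNReal.ofReal (weight α β s)) (by fun_prop)]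
  refine ne_top_of_le_ne_top (b := ENNReal.ofReal (Real.exp (3 * β)) *
    ∫⁻ s in Ioc (0 : ℝ) 1, ENNReal.ofReal (s ^ (-α))) ?_ ?_
  · rw [lintegral_rpow_neg hα zero_le_one]
    exact ENNReal.mul_ne_top ENNReal.ofReal_ne_top ENNReal.ofReal_ne_top
  · rw [← lintegral_const_mul _ (by fun_prop)]
    refine setLIntegral_mono' measurableSet_Ioc fun s hs => ?_
    rw [← ENNReal.ofReal_mul (Real.exp_pos _).le, weight, mul_comm]
    have hs1 := hs.1
    apply ENNReal.ofReal_le_ofReal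
    refine mul_le_mul_of_nonneg_right (Real.exp_le_exp.2 ?_) (by positivity)
    nlinarith [mul_le_of_le_one_right hβ hs.2]

/-- Staying at distance `r` from the singularity makes the convolution continuous. -/
lemma continuous_integral_cutKernel {r : ℝ} (hr : 0 < r)
    (hf : IntegrableOn (fun p : ℝ × ℝ => f p.1 p.2) (strip 1)) :
    Continuous fun q : ℝ × ℝ => ∫ p in strip 1, cutKernel (Ioi r) q.1 q.2 p * f p.1 p.2 := by
  rw [continuous_iff_continuousAt]
  rintro ⟨t, x⟩
  have hr0 : Ioi r ⊆ Ioi 0 := Ioi_subset_Ioi hr.le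
  set M : ℝ := 2 * ∑' n : ℕ, Real.exp (-((n + 1 : ℝ) ^ 2 * Real.pi ^ 2 * r / 2)) with hM
  have hM0 : 0 ≤ M := by
    rw [hM]; exact mul_nonneg zero_le_two (tsum_nonneg fun n => (Real.exp_pos _).le)
  refine continuousAt_of_dominated (bound := fun p => M * ‖f p.1 p.2‖)
    (Filter.Eventually.of_forall fun q => ?_) (Filter.Eventually.of_forall fun q => ?_)
    (hf.norm.const_mul M) ?_
  · exact (measurable_cutKernel measurableSet_Ioi hr0 q.1 q.2).aestronglyMeasurable.mul
      hf.aestronglyMeasurable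
  · refine Filter.Eventually.of_forall fun p => ?_
    rw [norm_mul]
    gcongr
    simp only [cutKernel, indicator]
    split_ifs with h
    · exact abs_heatKernel_le hr (le_of_lt h) _ _
    · simpa using hM0
  · -- only the jump time `s = t - r` has to be excluded
    have hnull : ∀ᵐ p : ℝ × ℝ ∂volume.restrict (strip 1), p.1 ≠ t - r := by
      refine ae_restrict_of_ae ?_
      rw [ae_iff]
      have : {p : ℝ × ℝ | ¬ p.1 ≠ t - r} = {t - r} ×ˢ univ := by
        ext p; simp
      rw [this, Measure.volume_eq_prod, Measure.prod_prod]
      simp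
    filter_upwards [hnull] with p hp
    refine ContinuousAt.mul ?_ continuousAt_const
    have hcts : Continuous fun q : ℝ × ℝ => q.1 - p.1 := by fun_prop
    rcases lt_or_gt_of_ne (show t - p.1 ≠ r by intro h; apply hp; linarith) with h | h
    · have hev : (fun q : ℝ × ℝ => cutKernel (Ioi r) q.1 q.2 p) =ᶠ[nhds (t, x)] fun _ => 0 := by
        filter_upwards [(isOpen_Iio.preimage hcts).mem_nhds (show (t, x) ∈ _ from h)] with q hq
        exact cutKernel_of_notMem fun hq' => lt_asymm (mem_Ioi.1 hq') hq
      exact continuousAt_const.congr hev.symm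
    · have hev : (fun q : ℝ × ℝ => cutKernel (Ioi r) q.1 q.2 p) =ᶠ[nhds (t, x)]
          fun q => heatKernel (q.1 - p.1) q.2 p.2 := by
        filter_upwards [(isOpen_Ioi.preimage hcts).mem_nhds (show (t, x) ∈ _ from h)] with q hq
        exact cutKernel_of_mem hq
      refine ContinuousAt.congr ?_ hev.symm
      have hat := continuousOn_heatKernel.continuousAt (x := (t - p.1, x, p.2))
        ((isOpen_Ioi.prod isOpen_univ).mem_nhds ⟨hr.trans h, mem_univ _⟩)
      exact ContinuousAt.comp (f := fun q : ℝ × ℝ => (q.1 - p.1, q.2, p.2)) (x := (t, x)) hat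
        (by fun_prop)

lemma cutKernel_Ioi_sub {r : ℝ} (hr : 0 ≤ r) (t x : ℝ) (p : ℝ × ℝ) :
    cutKernel (Ioi 0) t x p - cutKernel (Ioi r) t x p = cutKernel (Ioc 0 r) t x p := by
  simp only [cutKernel, indicator, mem_preimage, mem_Ioi, mem_Ioc]
  by_cases h1 : 0 < t - p.1 <;> by_cases h2 : r < t - p.1
  · simp [h1, h2, not_le.2 h2]
  · simp [h1, h2, not_lt.1 h2]
  · exact absurd (hr.trans_lt h2) h1
  · simp [h1, h2]

lemma edist_lebConv_le (hα : α ∈ Ioo (0 : ℝ) 1) (hβ : 0 ≤ β)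
    (hf : AEStronglyMeasurable (fun p : ℝ × ℝ => f p.1 p.2) (volume.restrict (strip 1)))
    (hfin : energy α β f ≠ ∞) {t r τ : ℝ} (hr : 0 < r) (hτ : 0 < τ) (ht : t ≤ 1)
    (hτt : τ ≤ t - r) (x : ℝ) :
    edist (lebConv f t x) (∫ p in strip 1, cutKernel (Ioi r) t x p * f p.1 p.2) ≤
      ENNReal.ofReal (4 * τ ^ (-α) * Real.exp (3 * β) * r ^ (1 / 2 : ℝ)) ^ (1 / 2 : ℝ) *
        energy α β f ^ (1 / 2 : ℝ) := by
  have ht0 : 0 < t := by linarith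
  have hfi := integrableOn_of_energy_ne_top hα.2 hβ hf hfin
  have hi0 := integrable_cutKernel_mul hα hβ hf hfin ht0 x
  have hA : Ioc 0 r ⊆ Ioi 0 := Ioc_subset_Ioi_self
  have hK := measurable_cutKernel measurableSet_Ioc hA t x
  have hle := (lintegral_mul_le_energy (α := α) (β := β) hK hf).trans
    (mul_le_mul_left (ENNReal.rpow_le_rpow
      ((lintegral_cutKernel_sq_le measurableSet_Ioc hA α β t x).trans
        ((lintegral_mono_set inter_subset_right).trans
          (lintegral_weight_near_le hα.1.le hβ hτ ht hr.le hτt)))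
      (by norm_num : (0 : ℝ) ≤ 1 / 2)) _)
  have hid : IntegrableOn (fun p => cutKernel (Ioc 0 r) t x p * f p.1 p.2) (strip 1) := by
    refine ⟨hK.aestronglyMeasurable.mul hf, hle.trans_lt (ENNReal.mul_lt_top ?_ ?_)⟩
    · exact ENNReal.rpow_lt_top_of_nonneg (by norm_num) ENNReal.ofReal_ne_top
    · exact ENNReal.rpow_lt_top_of_nonneg (by norm_num) hfin
  have heq : ∀ p : ℝ × ℝ, cutKernel (Ioi 0) t x p * f p.1 p.2 - cutKernel (Ioc 0 r) t x p *
      f p.1 p.2 = cutKernel (Ioi r) t x p * f p.1 p.2 := fun p => by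
    rw [← cutKernel_Ioi_sub hr.le]; ring
  have hdiff : lebConv f t x - ∫ p in strip 1, cutKernel (Ioi r) t x p * f p.1 p.2 =
      ∫ p in strip 1, cutKernel (Ioc 0 r) t x p * f p.1 p.2 := by
    rw [lebConv_eq_integral_cutKernel f ht]
    simp_rw [← heq]
    rw [integral_sub hi0 hid, sub_sub_cancel]
  rw [edist_eq_enorm_sub, hdiff]
  exact (enorm_integral_le_lintegral_enorm _).trans hle

lemma continuousOn_lebConv (hα : α ∈ Ioo (0 : ℝ) 1) (hβ : 0 ≤ β)
    (hf : AEStronglyMeasurable (fun p : ℝ × ℝ => f p.1 p.2) (volume.restrict (strip 1)))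
    (hfin : energy α β f ≠ ∞) :
    ContinuousOn (fun p : ℝ × ℝ => lebConv f p.1 p.2) (strip 1) := by
  refine continuousOn_of_locally_uniform_approx_of_continuousWithinAt fun q hq u hu => ?_
  obtain ⟨ε, hε, hεu⟩ := mem_uniformity_edist.1 hu
  have ht0 : 0 < q.1 := hq.1.1
  have hlim : Filter.Tendsto (fun r : ℝ =>
      ENNReal.ofReal (4 * (q.1 / 4) ^ (-α) * Real.exp (3 * β) * r ^ (1 / 2 : ℝ)) ^ (1 / 2 : ℝ) *
        energy α β f ^ (1 / 2 : ℝ)) (nhdsWithin 0 (Ioi 0)) (nhds 0) := by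
    have hc : Continuous fun r : ℝ =>
        ENNReal.ofReal (4 * (q.1 / 4) ^ (-α) * Real.exp (3 * β) * r ^ (1 / 2 : ℝ)) ^
          (1 / 2 : ℝ) := by
      refine ENNReal.continuous_rpow_const.comp (ENNReal.continuous_ofReal.comp ?_)
      exact continuous_const.mul (Real.continuous_rpow_const (by norm_num))
    have h1 := (hc.tendsto 0).mono_left (nhdsWithin_le_nhds (s := Ioi 0))
    have h2 := ENNReal.Tendsto.mul_const h1 (b := energy α β f ^ (1 / 2 : ℝ))
      (Or.inr (ENNReal.rpow_ne_top_of_nonneg (by norm_num) hfin))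
    simpa using h2
  obtain ⟨r, ⟨hrε, hr0⟩, hrq⟩ := (((hlim.eventually (gt_mem_nhds hε)).and
    self_mem_nhdsWithin).and (nhdsWithin_le_nhds
      (Iio_mem_nhds (show (0 : ℝ) < q.1 / 4 by positivity)))).exists
  refine ⟨strip 1 ∩ {p | q.1 / 2 < p.1}, ?_, _, (continuous_integral_cutKernel hr0
    (integrableOn_of_energy_ne_top hα.2 hβ hf hfin)).continuousWithinAt, fun p hp => hεu ?_⟩
  · refine Filter.inter_mem self_mem_nhdsWithin (nhdsWithin_le_nhds ?_)
    exact (isOpen_lt continuous_const continuous_fst).mem_nhds (half_lt_self ht0)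
  · refine (edist_lebConv_le hα hβ hf hfin hr0 (by positivity : 0 < q.1 / 4) hp.1.1.2 ?_
      p.2).trans_lt hrε
    have h1 : q.1 / 2 < p.1 := hp.2
    have h2 : r < q.1 / 4 := hrq
    linarith

end

/-! ### Random fields: measurability -/

section
variable {Ω : Type*}

/-- The field extended by `0` outside `𝒟(1)`, as a function on `Ω × ℝ²`. -/
def stripField (X : ℝ → ℝ → Ω → ℝ) (z : Ω × (ℝ × ℝ)) : ℝ :=
  (strip 1).indicator (fun p => X p.1 p.2 z.1) z.2

lemma stripField_of_mem {X : ℝ → ℝ → Ω → ℝ} {p : ℝ × ℝ} (hp : p ∈ strip 1) (ω : Ω) :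
    stripField X (ω, p) = X p.1 p.2 ω :=
  indicator_of_mem hp _

lemma energy_eq_stripField (X : ℝ → ℝ → Ω → ℝ) (α β : ℝ) (ω : Ω) :
    energy α β (fun s y => X s y ω) =
      ∫⁻ p in strip 1, ‖stripField X (ω, p)‖ₑ ^ 2 * ENNReal.ofReal (weight α β p.1)⁻¹ :=
  setLIntegral_congr_fun (measurableSet_strip 1) fun p hp => by
    simp only [stripField_of_mem hp]

variable [mΩ : MeasurableSpace Ω]

lemma predictable_le_prod (ℱ : Filtration ℝ≥0 mΩ) :
    ℱ.predictable ≤ (inferInstance : MeasurableSpace (ℝ≥0 × Ω)) :=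
  measurableSpace_le_predictable_of_measurableSet
    (fun A hA => (measurableSet_singleton _).prod (ℱ.le _ A hA))
    (fun _ A hA => measurableSet_Ioi.prod (ℱ.le _ A hA))

lemma IsPredictableField.measurable_stripField {ℱ : Filtration ℝ≥0 mΩ} {X : ℝ → ℝ → Ω → ℝ}
    (h : IsPredictableField ℱ X) : Measurable (stripField X) := by
  have hF : Measurable (fun q : (ℝ≥0 × Ω) × Icc (0 : ℝ) 1 =>
      if q.1.1 = 0 then 0 else X q.1.1 q.2 q.1.2) :=
    Measurable.mono h (sup_le_sup (MeasurableSpace.comap_mono (predictable_le_prod ℱ)) le_rfl)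
      le_rfl
  have hφ : Measurable (fun z : Ω × (ℝ × ℝ) =>
      (((z.2.1.toNNReal, z.1), projIcc (0 : ℝ) 1 zero_le_one z.2.2) :
        (ℝ≥0 × Ω) × Icc (0 : ℝ) 1)) := by
    have := (continuous_projIcc (h := zero_le_one (α := ℝ))).measurable
    fun_prop
  have hind := (hF.comp hφ).indicator (measurable_snd (measurableSet_strip 1) :
    MeasurableSet ((Prod.snd : Ω × (ℝ × ℝ) → ℝ × ℝ) ⁻¹' strip 1))
  convert hind using 1
  ext ⟨ω, p⟩
  by_cases hp : p ∈ strip 1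
  · rw [stripField_of_mem hp, indicator_of_mem (show (ω, p) ∈ Prod.snd ⁻¹' strip 1 from hp)]
    have h0 : p.1.toNNReal ≠ 0 := by simpa using hp.1.1
    simp [h0, Real.coe_toNNReal _ hp.1.1.le, projIcc_of_mem zero_le_one hp.2]
  · rw [indicator_of_notMem (show (ω, p) ∉ Prod.snd ⁻¹' strip 1 from hp)]
    exact indicator_of_notMem hp _

variable {X : ℝ → ℝ → Ω → ℝ}

lemma aestronglyMeasurable_path (hX : Measurable (stripField X)) (ω : Ω) :
    AEStronglyMeasurable (fun p : ℝ × ℝ => X p.1 p.2 ω) (volume.restrict (strip 1)) := by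
  refine AEStronglyMeasurable.congr
    (hX.comp measurable_prodMk_left : Measurable fun p => stripField X (ω, p)).aestronglyMeasurable
    ?_
  filter_upwards [ae_restrict_mem (measurableSet_strip 1)] with p hp
  exact stripField_of_mem hp ω

lemma measurable_energy (hX : Measurable (stripField X)) (α β : ℝ) :
    Measurable fun ω => energy α β fun s y => X s y ω := by
  simp_rw [energy_eq_stripField]
  have hw := measurable_weight α β
  exact Measurable.lintegral_prod_right' (f := fun z : Ω × (ℝ × ℝ) =>
    ‖stripField X z‖ₑ ^ 2 * ENNReal.ofReal (weight α β z.2.1)⁻¹) (by fun_prop)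

lemma measurable_lebConv (hX : Measurable (stripField X)) {t : ℝ} (ht : t ≤ 1) (x : ℝ) :
    Measurable fun ω => lebConv (fun s y => X s y ω) t x := by
  have hK := measurable_cutKernel measurableSet_Ioi subset_rfl t x
  have h : StronglyMeasurable fun z : Ω × (ℝ × ℝ) =>
      cutKernel (Ioi 0) t x z.2 * stripField X z :=
    ((hK.comp measurable_snd).mul hX).stronglyMeasurable
  convert (h.integral_prod_right' (ν := volume.restrict (strip 1))).measurable using 1
  ext ω
  rw [lebConv_eq_integral_cutKernel _ ht]
  refine setIntegral_congr_fun (measurableSet_strip 1) fun p hp => ?_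
  simp only [stripField_of_mem hp]

/-- For a function continuous on the strip, a countable dense set computes the weighted sup-norm. -/
lemma weightedSup_eq_biSup_of_continuousOn {T a b : ℝ} {D : Set (ℝ × ℝ)} (hD : D ⊆ strip T)
    (hdense : strip T ⊆ closure D) {f : ℝ → ℝ → ℝ}
    (hf : ContinuousOn (fun p : ℝ × ℝ => f p.1 p.2) (strip T)) :
    weightedSup T a b f =
      ⨆ p ∈ D, ENNReal.ofReal (p.1 ^ a * Real.exp (-b * p.1)) * ‖f p.1 p.2‖ₑ := by
  refine le_antisymm (iSup₂_le fun q hq => ?_) (biSup_mono hD)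
  have hφ : ContinuousWithinAt (fun p : ℝ × ℝ =>
      ENNReal.ofReal (p.1 ^ a * Real.exp (-b * p.1)) * ‖f p.1 p.2‖ₑ) D q := by
    have h1 : ContinuousWithinAt (fun p : ℝ × ℝ => p.1 ^ a * Real.exp (-b * p.1)) D q := by
      have h2 : ContinuousAt (fun p : ℝ × ℝ => p.1 ^ a) q :=
        continuousAt_fst.rpow_const (Or.inl (ne_of_gt hq.1.1))
      exact (h2.mul (by fun_prop)).continuousWithinAt
    exact ENNReal.Tendsto.mul (ENNReal.tendsto_ofReal h1) (Or.inr enorm_ne_top)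
      ((continuous_enorm.tendsto _).comp ((hf q hq).mono hD)) (Or.inr ENNReal.ofReal_ne_top)
  have : (nhdsWithin q D).NeBot := mem_closure_iff_nhdsWithin_neBot.1 (hdense hq)
  refine le_of_tendsto hφ ?_
  filter_upwards [self_mem_nhdsWithin] with p hp
  exact le_iSup₂ (f := fun (p : ℝ × ℝ) (_ : p ∈ D) =>
    ENNReal.ofReal (p.1 ^ a * Real.exp (-b * p.1)) * ‖f p.1 p.2‖ₑ) p hp

lemma aemeasurable_weightedSup_lebConv {P : Measure Ω} (hX : Measurable (stripField X)) (a b : ℝ)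
    (hc : ∀ᵐ ω ∂P, ContinuousOn (fun p : ℝ × ℝ => lebConv (fun s y => X s y ω) p.1 p.2)
      (strip 1)) :
    AEMeasurable (fun ω => weightedSup 1 a b (lebConv fun s y => X s y ω)) P := by
  obtain ⟨D, hD, hDc, hdense⟩ :=
    (TopologicalSpace.IsSeparable.of_separableSpace (strip 1)).exists_countable_dense_subset
  refine ⟨fun ω => ⨆ p ∈ D, ENNReal.ofReal (p.1 ^ a * Real.exp (-b * p.1)) *
    ‖lebConv (fun s y => X s y ω) p.1 p.2‖ₑ, ?_, ?_⟩
  · exact Measurable.biSup D hDc fun p hp =>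
      (measurable_lebConv hX (hD hp).1.2 p.2).enorm.const_mul _
  · filter_upwards [hc] with ω hω
    exact weightedSup_eq_biSup_of_continuousOn hD hdense hω

/-! ### Random fields: moments of the energy -/

/-- The finite measure `s^{-α} exp (-βs) ds dy` on `𝒟(1)`. -/
def energyMeasure (α β : ℝ) : Measure (ℝ × ℝ) :=
  (volume.restrict (strip 1)).withDensity fun p =>
    ENNReal.ofReal (p.1 ^ (-α) * Real.exp (-(β * p.1)))

instance (α β : ℝ) : SFinite (energyMeasure α β) := by
  unfold energyMeasure; infer_instance

lemma energyMeasure_univ_le {α β : ℝ} (hα : α < 1) (hβ : 0 < β) :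
    energyMeasure α β univ ≤ ENNReal.ofReal (Real.Gamma (1 - α) * β ^ (-(1 - α))) := by
  rw [energyMeasure, withDensity_apply _ MeasurableSet.univ, Measure.restrict_univ,
    lintegral_strip_fst (g := fun s => ENNReal.ofReal (s ^ (-α) * Real.exp (-(β * s))))
      (by fun_prop)]
  exact lintegral_rpow_neg_mul_exp_le hα hβ

lemma ae_energyMeasure_mem_strip (α β : ℝ) : ∀ᵐ p ∂energyMeasure α β, p ∈ strip 1 :=
  (withDensity_absolutelyContinuous _ _).ae_le (ae_restrict_mem (measurableSet_strip 1))

/-- The field scaled by the weight `t^α exp (-βt)`. -/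
def scaledField (α β : ℝ) (X : ℝ → ℝ → Ω → ℝ) (z : Ω × (ℝ × ℝ)) : ℝ :=
  z.2.1 ^ α * Real.exp (-β * z.2.1) * stripField X z

lemma measurable_scaledField (hX : Measurable (stripField X)) (α β : ℝ) :
    Measurable (scaledField α β X) := by
  unfold scaledField; fun_prop

lemma energy_eq_lintegral_scaledField (hX : Measurable (stripField X)) (α β : ℝ) (ω : Ω) :
    energy α β (fun s y => X s y ω) =
      ∫⁻ p, ‖scaledField α β X (ω, p)‖ₑ ^ 2 ∂energyMeasure α β := by
  have hs : Measurable fun p => scaledField α β X (ω, p) :=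
    (measurable_scaledField hX α β).comp measurable_prodMk_left
  rw [energy_eq_stripField, energyMeasure,
    lintegral_withDensity_eq_lintegral_mul _ (by fun_prop) (by fun_prop)]
  refine setLIntegral_congr_fun (measurableSet_strip 1) fun p hp => ?_
  have hp0 : 0 < p.1 := hp.1.1
  simp only [Pi.mul_apply, scaledField]
  rw [enorm_mul, mul_pow, Real.enorm_of_nonneg
    (show 0 ≤ p.1 ^ α * Real.exp (-β * p.1) by positivity),
    ← ENNReal.ofReal_pow (by positivity),
    ← mul_assoc, ← ENNReal.ofReal_mul (by positivity), mul_comm]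
  congr 2
  have e1 : p.1 ^ (-α) * (p.1 ^ α) ^ 2 = p.1 ^ α := by
    rw [sq, ← mul_assoc, ← Real.rpow_add hp0]; simp
  have e2 : Real.exp (-(β * p.1)) * Real.exp (-β * p.1) ^ 2 = (Real.exp (3 * β * p.1))⁻¹ := by
    rw [← Real.exp_nat_mul, ← Real.exp_add, ← Real.exp_neg]; congr 1; push_cast; ring
  calc (weight α β p.1)⁻¹ = p.1 ^ α * (Real.exp (3 * β * p.1))⁻¹ := by
        rw [weight, mul_inv, Real.rpow_neg hp0.le, inv_inv]
    _ = p.1 ^ (-α) * (p.1 ^ α) ^ 2 *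
          (Real.exp (-(β * p.1)) * Real.exp (-β * p.1) ^ 2) := by rw [e1, e2]
    _ = _ := by ring

lemma lintegral_scaledField_rpow_le {P : Measure Ω} {α β k : ℝ} (hk : 0 < k) {p : ℝ × ℝ}
    (hp : p ∈ strip 1) :
    ∫⁻ ω, ‖scaledField α β X (ω, p)‖ₑ ^ k ∂P ≤ momentNorm P k α β 1 X ^ k := by
  have hp0 : 0 < p.1 := hp.1.1
  have h1 : ENNReal.ofReal (p.1 ^ α * Real.exp (-β * p.1)) *
      eLpNorm (X p.1 p.2) (ENNReal.ofReal k) P ≤ momentNorm P k α β 1 X :=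
    le_iSup₂ (f := fun (p : ℝ × ℝ) (_ : p ∈ strip 1) =>
      ENNReal.ofReal (p.1 ^ α * Real.exp (-β * p.1)) *
        eLpNorm (X p.1 p.2) (ENNReal.ofReal k) P) p hp
  refine le_trans (le_of_eq ?_) (ENNReal.rpow_le_rpow h1 hk.le)
  rw [eLpNorm_eq_lintegral_rpow_enorm_toReal (by simpa using hk) ENNReal.ofReal_ne_top,
    ENNReal.toReal_ofReal hk.le, ENNReal.mul_rpow_of_nonneg _ _ hk.le, ← ENNReal.rpow_mul,
    one_div_mul_cancel hk.ne', ENNReal.rpow_one, ← lintegral_const_mul' _ _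
      (ENNReal.rpow_ne_top_of_nonneg hk.le ENNReal.ofReal_ne_top)]
  refine lintegral_congr fun ω => ?_
  simp only [scaledField]
  rw [enorm_mul, Real.enorm_of_nonneg (by positivity), stripField_of_mem hp,
    ENNReal.mul_rpow_of_nonneg _ _ hk.le]

/-- Jensen's inequality for the finite measure `energyMeasure α β` and Tonelli's theorem. -/
lemma lintegral_energy_rpow_le {P : Measure Ω} [SFinite P] (hX : Measurable (stripField X))
    (α β : ℝ) {k : ℝ} (hk : 2 ≤ k) :
    ∫⁻ ω, energy α β (fun s y => X s y ω) ^ (k / 2) ∂P ≤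
      momentNorm P k α β 1 X ^ k * energyMeasure α β univ ^ (k / 2) := by
  have hk0 : 0 < k := by linarith
  set ν := energyMeasure α β with hν
  have hS := measurable_scaledField hX α β
  have hjensen : ∀ ω, energy α β (fun s y => X s y ω) ^ (k / 2) ≤
      (∫⁻ p, ‖scaledField α β X (ω, p)‖ₑ ^ k ∂ν) * ν univ ^ (k / 2 - 1) := by
    intro ω
    have hs : Measurable fun p => scaledField α β X (ω, p) := hS.comp measurable_prodMk_left
    have h := ENNReal.rpow_le_rpow (eLpNorm'_le_eLpNorm'_mul_rpow_measure_univ (μ := ν)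
      two_pos hk hs.aestronglyMeasurable) hk0.le
    rw [ENNReal.mul_rpow_of_nonneg _ _ hk0.le] at h
    simp only [eLpNorm', ← ENNReal.rpow_mul] at h
    rw [one_div_mul_cancel hk0.ne', ENNReal.rpow_one,
      show (1 / 2 - 1 / k) * k = k / 2 - 1 by field_simp, show 1 / 2 * k = k / 2 by ring] at h
    rw [energy_eq_lintegral_scaledField hX]
    simpa only [ENNReal.rpow_two] using h
  have hmeas : Measurable fun z : Ω × (ℝ × ℝ) => ‖scaledField α β X z‖ₑ ^ k := by fun_prop
  calc _ ≤ ∫⁻ ω, (∫⁻ p, ‖scaledField α β X (ω, p)‖ₑ ^ k ∂ν) * ν univ ^ (k / 2 - 1) ∂P :=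
        lintegral_mono hjensen
    _ = (∫⁻ p, (∫⁻ ω, ‖scaledField α β X (ω, p)‖ₑ ^ k ∂P) ∂ν) * ν univ ^ (k / 2 - 1) := by
        rw [lintegral_mul_const _ hmeas.lintegral_prod_right',
          lintegral_lintegral_swap hmeas.aemeasurable]
    _ ≤ (∫⁻ _, momentNorm P k α β 1 X ^ k ∂ν) * ν univ ^ (k / 2 - 1) := by
        refine mul_le_mul_left (lintegral_mono_ae ?_) _
        filter_upwards [ae_energyMeasure_mem_strip α β] with p hp
        exact lintegral_scaledField_rpow_le hk0 hp
    _ = momentNorm P k α β 1 X ^ k * (ν univ ^ (1 : ℝ) * ν univ ^ (k / 2 - 1)) := by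
        rw [lintegral_const, ENNReal.rpow_one, mul_assoc]
    _ = _ := by
        rw [← ENNReal.rpow_add_of_nonneg _ _ zero_le_one (by linarith)]
        ring_nf

end

end HeatConv

end

theorem proposition4p2 (α αbar : ℝ) (hα : α ∈ Set.Ioo (0 : ℝ) 1) (hαbar : α < αbar) :
    ∃ c : ℝ, 0 < c ∧
      ∀ (Ω : Type*) [mΩ : MeasurableSpace Ω] (P : MeasureTheory.Measure Ω)
        [MeasureTheory.IsProbabilityMeasure P] (ℱ : MeasureTheory.Filtration NNReal mΩ)
        (β k : ℝ) (X : ℝ → ℝ → Ω → ℝ),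
        Real.exp 1 ≤ β → 2 ≤ k → HeatConv.MemPredictable P ℱ k α β X →
        -- almost surely, every integral defining the convolution up to time 1 converges absolutely
        (∀ᵐ ω ∂P, ∀ p ∈ HeatConv.strip 1, MeasureTheory.IntegrableOn
          (HeatConv.convIntegrand (fun s y => X s y ω) p.1 p.2) (HeatConv.strip p.1)) ∧
        -- almost surely, the convolution lies in the weighted space
        (∀ᵐ ω ∂P, HeatConv.MemWeighted 1 αbar (2 * β)
          (HeatConv.lebConv fun s y => X s y ω)) ∧
        -- the weighted norm is a random variable, and its `k`-th moment is bounded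
        AEMeasurable (fun ω => HeatConv.weightedSup 1 αbar (2 * β)
          (HeatConv.lebConv fun s y => X s y ω)) P ∧
        ∀ δ ∈ Set.Ioo (0 : ℝ) 1,
          ∫⁻ ω, (HeatConv.weightedSup 1 αbar (2 * β)
              (HeatConv.lebConv fun s y => X s y ω)) ^ k ∂P ≤
            (ENNReal.ofReal (c / β ^ ((1 - δ) / 2)) * HeatConv.momentNorm P k α β 1 X) ^ k := by
  have hα1 : 0 < 1 - α := sub_pos.2 hα.2
  have hC := HeatConv.energyConst_pos hα.2
  have hΓ : 0 < Real.Gamma (1 - α) := Real.Gamma_pos_of_pos hα1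
  refine ⟨√(HeatConv.energyConst α * Real.Gamma (1 - α)), by positivity, ?_⟩
  intro Ω mΩ P _ ℱ β k X hβe hk hX
  have hβ1 : 1 ≤ β := (Real.one_le_exp zero_le_one).trans hβe
  have hβ0 : 0 < β := by linarith
  have hk2 : 0 ≤ k / 2 := by linarith
  have hm := hX.predictable.measurable_stripField
  have hpath := HeatConv.aestronglyMeasurable_path hm
  have hmom : ∫⁻ ω, HeatConv.energy α β (fun s y => X s y ω) ^ (k / 2) ∂P ≤
      HeatConv.momentNorm P k α β 1 X ^ k *
        ENNReal.ofReal (Real.Gamma (1 - α) * β ^ (-(1 - α))) ^ (k / 2) :=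
    (HeatConv.lintegral_energy_rpow_le hm α β hk).trans (mul_le_mul_right
      (ENNReal.rpow_le_rpow (HeatConv.energyMeasure_univ_le hα.2 hβ0) hk2) _)
  have hfin : ∀ᵐ ω ∂P, HeatConv.energy α β (fun s y => X s y ω) ≠ ∞ := by
    have h := ae_lt_top ((HeatConv.measurable_energy hm α β).pow_const (k / 2))
      (ne_top_of_le_ne_top (ENNReal.mul_ne_top
        (ENNReal.rpow_ne_top_of_nonneg (by linarith) hX.momentNorm_lt_top.ne)
        (ENNReal.rpow_ne_top_of_nonneg hk2 ENNReal.ofReal_ne_top)) hmom)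
    filter_upwards [h] with ω hω htop
    rw [htop, ENNReal.top_rpow_of_pos (by linarith)] at hω
    exact lt_irrefl _ hω
  have hcont : ∀ᵐ ω ∂P, ContinuousOn
      (fun p : ℝ × ℝ => HeatConv.lebConv (fun s y => X s y ω) p.1 p.2) (HeatConv.strip 1) := by
    filter_upwards [hfin] with ω hω
    exact HeatConv.continuousOn_lebConv hα hβ0.le (hpath ω) hω
  have hsup := fun ω => HeatConv.weightedSup_lebConv_le (f := fun s y => X s y ω) hα hαbar hβ0
    (hpath ω)
  refine ⟨?_, ?_, HeatConv.aemeasurable_weightedSup_lebConv hm _ _ hcont, fun δ hδ => ?_⟩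
  · filter_upwards [hfin] with ω hω p hp
    exact HeatConv.integrableOn_convIntegrand hα hβ0.le (hpath ω) hω hp.1 p.2
  · filter_upwards [hfin, hcont] with ω hω hc
    exact ⟨hc, (hsup ω).trans_lt (ENNReal.rpow_lt_top_of_nonneg (by norm_num)
      (ENNReal.mul_ne_top ENNReal.ofReal_ne_top hω))⟩
  · set A : ℝ := HeatConv.energyConst α * β ^ (-α) with hA
    set B : ℝ := Real.Gamma (1 - α) * β ^ (-(1 - α)) with hB
    have hA0 : 0 ≤ A := by positivity
    have hB0 : 0 ≤ B := by positivity
    -- the powers `β^{-α}` and `β^{-(1-α)}` multiply to `β^{-1}`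
    have hAB : A * B = HeatConv.energyConst α * Real.Gamma (1 - α) / β := by
      have : β ^ (-α) * β ^ (-(1 - α)) = β⁻¹ := by
        rw [← Real.rpow_add hβ0, ← Real.rpow_neg_one]; ring_nf
      rw [hA, hB, div_eq_mul_inv, ← this]; ring
    have hconst : √(A * B) ≤
        √(HeatConv.energyConst α * Real.Gamma (1 - α)) / β ^ ((1 - δ) / 2) := by
      rw [hAB, Real.sqrt_div' _ hβ0.le]
      refine div_le_div_of_nonneg_left (Real.sqrt_nonneg _) (by positivity) ?_
      rw [Real.sqrt_eq_rpow]
      exact Real.rpow_le_rpow_of_exponent_le hβ1 (by linarith [hδ.1])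
    calc _ ≤ ∫⁻ ω, ENNReal.ofReal A ^ (k / 2) *
          HeatConv.energy α β (fun s y => X s y ω) ^ (k / 2) ∂P := by
          refine lintegral_mono fun ω => ?_
          rw [← ENNReal.mul_rpow_of_nonneg _ _ hk2]
          refine (ENNReal.rpow_le_rpow (hsup ω) (by linarith : 0 ≤ k)).trans_eq ?_
          rw [← ENNReal.rpow_mul]; ring_nf
      _ = ENNReal.ofReal A ^ (k / 2) *
          ∫⁻ ω, HeatConv.energy α β (fun s y => X s y ω) ^ (k / 2) ∂P :=
          lintegral_const_mul _ ((HeatConv.measurable_energy hm α β).pow_const _)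
      _ ≤ ENNReal.ofReal A ^ (k / 2) *
          (HeatConv.momentNorm P k α β 1 X ^ k * ENNReal.ofReal B ^ (k / 2)) := by gcongr
      _ = (ENNReal.ofReal √(A * B) * HeatConv.momentNorm P k α β 1 X) ^ k := by
          rw [ENNReal.mul_rpow_of_nonneg _ _ (by linarith : 0 ≤ k), Real.sqrt_eq_rpow,
            ← ENNReal.ofReal_rpow_of_nonneg (by positivity) (by norm_num), ← ENNReal.rpow_mul,
            show 1 / 2 * k = k / 2 by ring, ENNReal.ofReal_mul hA0,
            ENNReal.mul_rpow_of_nonneg _ _ hk2]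
          ring
      _ ≤ _ := by
          have hk0 : 0 ≤ k := by linarith
          gcongr
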